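/- Let $q,h>0$, $\theta_+=(1+q/h)^{1/4}-1$ and $0<\theta_{ig}<\theta_{hl}<\theta_+$, and let $F(\theta)=q-h((1+\theta)^4-1)$. Put $$Q_+=\{(R,c): R>0,\ c\ge qR/\theta_{hl}\},\qquad G(R,c)=(e^{cR}-1-cR)\,q-c^2(\theta_{ig}e^{cR}-\theta_{hl}).$$ For $c>0$ let $S_c$ be the stable separatrix of the equilibrium $(\theta_+,0)$ of the system $u'=v,\ v'=cv-F(u)$ in the strip $[\theta_{hl},\theta_+]\times[0,\infty)$, i.e. the set of points of the strip whose forward trajectory stays in the strip and tends to $(\theta_+,0)$. Then: 1. There are $R_0>0$ and a continuous, strictly decreasing function $\varphi:(0,R_0]\to\mathbb R$ such that the level set $\{(R,c)\in Q_+: G(R,c)=0\}$ is the graph of $\varphi$; moreover $\varphi(R_0)=qR_0/\theta_{hl}$ and $\varphi(R)\to+\infty$ as $R\to0^+$. 2. There is a continuous, strictly increasing function $\psi:[0,\infty)\to\mathbb R$ whose graph is the set of all $(R,c)$ with $R\ge0$, $c>0$ and $(\theta_{hl},\,c\theta_{hl}-qR)\in S_c$; moreover $\psi(R)>qR/\theta_{hl}$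 for all $R\ge0$. 3. The graphs of $\varphi$ and $\psi$ have exactly one common point $(R^*,c^*)$, that is, there is exactly one pair with $c^*=\varphi(R^*)=\psi(R^*)$, and this point lies in the interior of $Q_+$. -/

import Mathlib

open Set Filter Topology

noncomputable section

/-- The temperature far behind the front, `θ₊ = (1 + q/h)^(1/4) - 1`. -/
def thetaPlus (q h : ℝ) : ℝ := (1 + q / h) ^ (1 / 4 : ℝ) - 1

/-- The nonlinearity `F(θ) = q - h((1+θ)⁴ - 1)`. -/
def nonlinF (q h θ : ℝ) : ℝ := q - h * ((1 + θ) ^ 4 - 1)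

/-- The domain `Q₊` of the quadrant, with points written `p = (R, c)`. -/
def Qplus (q θhl : ℝ) : Set (ℝ × ℝ) := {p | 0 < p.1 ∧ q * p.1 / θhl ≤ p.2}

/-- The function `G(R,c)` of the transcendental relation. -/
def transG (q θig θhl R c : ℝ) : ℝ :=
  (Real.exp (c * R) - 1 - c * R) * q - c ^ 2 * (θig * Real.exp (c * R) - θhl)

/-- The level set `{(R,c) ∈ Q₊ | G(R,c) = 0}`. -/
def phiCurve (q θig θhl : ℝ) : Set (ℝ × ℝ) :=
  {p | p ∈ Qplus q θhl ∧ transG q θig θhl p.1 p.2 = 0}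

/-- The strip `[θhl, θ₊] × [0, ∞)` of the phase plane. -/
def phaseStrip (θhl θp : ℝ) : Set (ℝ × ℝ) := {p | p.1 ∈ Icc θhl θp ∧ 0 ≤ p.2}

/-- `(u, v)` is a trajectory on `[0, ∞)` of the vector field `X_c : u' = v, v' = c v - F(u)`. -/
def IsForwardTrajectory (F : ℝ → ℝ) (c : ℝ) (u v : ℝ → ℝ) : Prop :=
  ∀ t, 0 ≤ t →
    HasDerivWithinAt u (v t) (Ici 0) t ∧ HasDerivWithinAt v (c * v t - F (u t)) (Ici 0) t

/-- The stable separatrix `S_c` of the equilibrium `(θ₊, 0)` in the strip `[θhl, θ₊] × [0, ∞)`: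
the points of the strip whose forward trajectory stays in the strip and tends to `(θ₊, 0)`. -/
def stableSeparatrix (F : ℝ → ℝ) (c θhl θp : ℝ) : Set (ℝ × ℝ) :=
  {p | ∃ u v : ℝ → ℝ, IsForwardTrajectory F c u v ∧ (u 0, v 0) = p ∧
    (∀ t, 0 ≤ t → (u t, v t) ∈ phaseStrip θhl θp) ∧
    Tendsto u atTop (𝓝 θp) ∧ Tendsto v atTop (𝓝 0)}

/-- The pairs `(R,c)`, `R ≥ 0`, `c > 0`, for which `c θhl - q R = v_c(θhl)`, where `v = v_c(u)` is
the separatrix `S_c` written as a graph; that is, `(θhl, c θhl - q R)` lies on `S_c`. -/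
def psiCurve (q h θhl : ℝ) : Set (ℝ × ℝ) :=
  {p | 0 ≤ p.1 ∧ 0 < p.2 ∧
    (θhl, p.2 * θhl - q * p.1) ∈ stableSeparatrix (nonlinF q h) p.2 θhl (thetaPlus q h)}

end

/-! Put `x = c R`. On the level set, `c ^ 2 = q * speedSq θig θhl x`, with a pole at `x = log (θhl /
θig)`. The function `θhl * (1 - exp (-x)) - θig * x` plays two roles: up to positive factors it is
minus the derivative of `speedSq`, and its sign decides whether `c ≥ q R / θhl`. Being concave and
zero at `0`, it has a single positive zero `y`, so `speedSq` decreases exactly on the part of the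
level set inside `Qplus`. There `c` falls and `R = x / c` rises with `x`, which gives `φ`
(`mem_phiCurve_iff`, `exists_phi`).

For `ψ`, use the distance `s = θ₊ - u`: the separatrix solves `dv/ds = F / v - c` with `v → 0` at `s
= 0`. Writing `v = s p(s)` turns this into a singular equation solved by a contraction
(`exists_singular_profile`); an energy-type product gives uniqueness (`stableSeparatrix_unique`). By
`separatrix_comparison` its height `V c` over `θhl` is nonincreasing and Lipschitz in `c`, so `R =
(c θhl - V c) / q` is strictly increasing in `c`, and `ψ` is its inverse. Positivity of `V` puts `ψ`
strictly above the line `c = q R / θhl`, on which `φ` ends; opposite monotonicity then gives exactly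
one crossing. -/

open scoped BoundedContinuousFunction

/-! ### Existence of the separatrix through a singular equation. -/

theorem abs_div_add_mul_sub_le {n m M κ c z w : ℝ} (hκ : 0 < κ) (hm : 0 ≤ m) (hmM : m ≤ M)
    (hn : M / κ ^ 2 ≤ n) (hz : κ ≤ z) (hw : κ ≤ w) :
    |(m / z - c + n * z) - (m / w - c + n * w)| ≤ n * |z - w| := by
  have hz0 : 0 < z := hκ.trans_le hz
  have hw0 : 0 < w := hκ.trans_le hw
  have e : (m / z - c + n * z) - (m / w - c + n * w) = (n - m / (z * w)) * (z - w) := by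
    field_simp
    ring
  have h1 : m / (z * w) ≤ n := by
    refine le_trans ?_ hn
    rw [sq]
    gcongr
    exact hm.trans hmM
  have h2 : 0 ≤ m / (z * w) := by positivity
  rw [e, abs_mul, abs_of_nonneg (by linarith)]
  exact mul_le_mul_of_nonneg_right (by linarith) (abs_nonneg _)

/-- For such `n` the expression is nondecreasing in `z ≥ κ`, so its value at `κ` is the minimum. The
bound makes `κ` a lower barrier for the fixed point in `exists_singular_profile`. -/
theorem le_div_add_mul {n m M κ c z : ℝ} (hκ : 0 < κ) (hm : 0 ≤ m) (hmM : m ≤ M)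
    (hn : M / κ ^ 2 ≤ n) (hκm : κ * (c + κ) ≤ m) (hz : κ ≤ z) :
    (n + 1) * κ ≤ m / z - c + n * z := by
  have hz0 : 0 < z := hκ.trans_le hz
  have e : m / z - c + n * z = (n - m / (z * κ)) * (z - κ) + (m / κ - c + n * κ) := by
    field_simp
    ring
  have h1 : m / (z * κ) ≤ n := by
    refine le_trans ?_ hn
    rw [sq]
    gcongr
    exact hm.trans hmM
  have h2 : c + κ ≤ m / κ := by
    rw [le_div_iff₀ hκ]
    linarith
  have := mul_nonneg (sub_nonneg.2 h1) (sub_nonneg.2 hz)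
  rw [e]
  linarith

theorem integral_pow_mul_const (n : ℕ) (C : ℝ) :
    ∫ x in (0 : ℝ)..1, x ^ n * C = C / (n + 1) := by
  rw [intervalIntegral.integral_mul_const, integral_pow]
  simp
  ring

/-- The singular equation `s p' = m(s) / p - c - p` has a bounded continuous positive solution. -/
theorem exists_singular_profile {m : ℝ → ℝ} (hm : Continuous m) {m₀ M c : ℝ} (hm₀ : 0 < m₀)
    (hlow : ∀ s, m₀ ≤ m s) (hup : ∀ s, m s ≤ M) (hc : 0 < c) :
    ∃ κ > 0, ∃ p : ℝ →ᵇ ℝ, (∀ s, κ ≤ p s) ∧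
      ∀ s > 0, HasDerivAt (fun s => s * p s) (m s / p s - c) s := by
  obtain ⟨κ, hκ, hκm⟩ : ∃ κ > 0, κ * (c + κ) ≤ m₀ := by
    refine ⟨min 1 (m₀ / (c + 1)), by positivity, ?_⟩
    have h1 := min_le_left 1 (m₀ / (c + 1))
    have h2 := min_le_right 1 (m₀ / (c + 1))
    have h3 : 0 < min 1 (m₀ / (c + 1)) := by positivity
    rw [le_div_iff₀ (by positivity)] at h2
    nlinarith
  obtain ⟨k, hk⟩ := exists_nat_ge (M / κ ^ 2)
  obtain ⟨n, hn⟩ : ∃ n : ℕ, n = k + 1 := ⟨_, rfl⟩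
  have hnM : M / κ ^ 2 ≤ n := by rw [hn]; push_cast; linarith
  have hmpos : ∀ s, 0 ≤ m s := fun s => hm₀.le.trans (hlow s)
  -- The equation is equivalent to `(s ^ (n+1) * p)' = s ^ n * (m / p - c + n * p)` for `s > 0`. The
  -- added `n * p` makes the bracket monotone and `n`-Lipschitz in `p ≥ κ`; truncation at `κ`
  -- extends it to all `p`.
  let N : ℝ → ℝ → ℝ := fun s y => m s / max κ y - c + n * max κ y
  have hN : Continuous (fun z : ℝ × ℝ => N z.1 z.2) := by
    have : ∀ z : ℝ × ℝ, max κ z.2 ≠ 0 := fun z => (lt_max_of_lt_left hκ).ne'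
    fun_prop (disch := exact this _)
  have hNlip : ∀ s y z, |N s y - N s z| ≤ n * |y - z| := fun s y z =>
    (abs_div_add_mul_sub_le hκ (hmpos s) (hup s) hnM (le_max_left _ _) (le_max_left _ _)).trans
      (mul_le_mul_of_nonneg_left (by
        simpa [max_comm] using abs_max_sub_max_le_abs y z κ) (Nat.cast_nonneg n))
  have hNlow : ∀ s y, (n + 1) * κ ≤ N s y := fun s y =>
    le_div_add_mul hκ (hmpos s) (hup s) hnM (hκm.trans (hlow s)) (le_max_left _ _)
  have hNbd : ∀ s y, |N s y| ≤ |M / κ| + c + n * (κ + |y|) := by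
    intro s y
    have h0 : |m s / max κ y| ≤ |M / κ| := by
      rw [abs_of_nonneg (div_nonneg (hmpos s) (hκ.le.trans (le_max_left _ _)))]
      refine le_trans ?_ (le_abs_self _)
      exact div_le_div₀ ((hmpos s).trans (hup s)) (hup s) hκ (le_max_left _ _)
    have h1 : |max κ y| ≤ κ + |y| := by
      rw [abs_of_nonneg (hκ.le.trans (le_max_left _ _))]
      exact max_le (by linarith [abs_nonneg y]) (by linarith [le_abs_self y])
    calc |N s y| ≤ |m s / max κ y - c| + |n * max κ y| := abs_add_le _ _
      _ ≤ |m s / max κ y| + |c| + |n * max κ y| := by gcongr; exact abs_sub _ _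
      _ ≤ _ := by
        rw [abs_mul, abs_of_pos hc, Nat.abs_cast]
        gcongr
  have hcont : ∀ p : ℝ →ᵇ ℝ,
      Continuous (fun z : ℝ × ℝ => z.2 ^ n * N (z.1 * z.2) (p (z.1 * z.2))) := fun p =>
    (continuous_snd.pow n).mul (hN.comp
      (f := fun z : ℝ × ℝ => (z.1 * z.2, p (z.1 * z.2))) (by fun_prop))
  have hcont' : ∀ (p : ℝ →ᵇ ℝ) (s : ℝ),
      Continuous (fun x : ℝ => x ^ n * N (s * x) (p (s * x))) := fun p s =>
    (hcont p).comp (Continuous.prodMk_right s)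
  have hle : ∀ (f : ℝ → ℝ) (C : ℝ), Continuous f → (∀ x ∈ Icc (0 : ℝ) 1, |f x| ≤ x ^ n * C) →
      |∫ x in (0 : ℝ)..1, f x| ≤ C / (n + 1) := by
    intro f C hf h
    rw [← integral_pow_mul_const]
    refine (intervalIntegral.abs_integral_le_integral_abs zero_le_one).trans ?_
    exact intervalIntegral.integral_mono_on zero_le_one (hf.abs.intervalIntegrable _ _)
      ((by fun_prop : Continuous fun x : ℝ => x ^ n * C).intervalIntegrable _ _) h
  let T : (ℝ →ᵇ ℝ) → (ℝ →ᵇ ℝ) := fun p =>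
    BoundedContinuousFunction.ofNormedAddCommGroup
      (fun s => ∫ x in (0 : ℝ)..1, x ^ n * N (s * x) (p (s * x)))
      (intervalIntegral.continuous_parametric_intervalIntegral_of_continuous' (hcont p) 0 1)
      ((|M / κ| + c + n * (κ + ‖p‖)) / (n + 1)) (by
        intro s
        refine hle _ _ (hcont' p s) fun x hx => ?_
        rw [abs_mul, abs_of_nonneg (pow_nonneg hx.1 n)]
        refine mul_le_mul_of_nonneg_left ((hNbd _ _).trans ?_) (pow_nonneg hx.1 n)
        gcongr
        exact p.norm_coe_le_norm _)
  have hT : ∀ p s, T p s = ∫ x in (0 : ℝ)..1, x ^ n * N (s * x) (p (s * x)) := fun p s => rfl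
  -- The Lipschitz constant `n` of `N` times `∫ x ^ n = 1 / (n + 1)`.
  let K : NNReal := ⟨n / (n + 1), by positivity⟩
  have hTc : ContractingWith K T := by
    refine ⟨?_, LipschitzWith.of_dist_le_mul fun p r => ?_⟩
    · change (n / (n + 1) : ℝ) < 1
      rw [div_lt_one (by positivity)]
      linarith
    · change dist (T p) (T r) ≤ (n / (n + 1) : ℝ) * dist p r
      rw [BoundedContinuousFunction.dist_le (by positivity)]
      intro s
      rw [Real.dist_eq, hT, hT, ← intervalIntegral.integral_sub
        ((hcont' p s).intervalIntegrable _ _) ((hcont' r s).intervalIntegrable _ _),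
        div_mul_eq_mul_div]
      refine hle _ _ ((hcont' p s).sub (hcont' r s)) fun x hx => ?_
      rw [← mul_sub, abs_mul, abs_of_nonneg (pow_nonneg hx.1 n)]
      refine mul_le_mul_of_nonneg_left ((hNlip _ _ _).trans ?_) (pow_nonneg hx.1 n)
      exact mul_le_mul_of_nonneg_left (BoundedContinuousFunction.dist_coe_le_dist (f := p) (g := r) (s * x))
        (Nat.cast_nonneg n)
  obtain ⟨p, hp⟩ : ∃ p, T p = p := ⟨_, hTc.fixedPoint_isFixedPt⟩
  have hps : ∀ s, p s = ∫ x in (0 : ℝ)..1, x ^ n * N (s * x) (p (s * x)) := fun s => by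
    rw [← hT, hp]
  have hpκ : ∀ s, κ ≤ p s := by
    intro s
    have e : κ = ∫ x in (0 : ℝ)..1, x ^ n * ((n + 1) * κ) := by
      rw [integral_pow_mul_const]
      field_simp
    rw [hps s]
    nth_rw 1 [e]
    refine intervalIntegral.integral_mono_on zero_le_one
      ((by fun_prop : Continuous fun x : ℝ => x ^ n * ((n + 1) * κ)).intervalIntegrable _ _)
      ((hcont' p s).intervalIntegrable _ _) fun x hx => ?_
    exact mul_le_mul_of_nonneg_left (hNlow _ _) (pow_nonneg hx.1 n)
  refine ⟨κ, hκ, p, hpκ, fun s hs => ?_⟩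
  have hg : Continuous (fun σ : ℝ => σ ^ n * N σ (p σ)) :=
    (continuous_id.pow n).mul (hN.comp (f := fun σ : ℝ => (σ, p σ)) (by fun_prop))
  -- The substitution `σ = s x` returns to an integral with variable endpoint, hence to
  -- differentiability of `p` away from `0`.
  have hI : ∀ s : ℝ, 0 < s → s ^ (n + 1) * p s = ∫ σ in (0 : ℝ)..s, σ ^ n * N σ (p σ) := by
    intro s hs
    have h1 := intervalIntegral.integral_comp_mul_left (a := 0) (b := 1)
      (fun σ => σ ^ n * N σ (p σ)) hs.ne'
    simp only [mul_pow, mul_zero, mul_one, mul_assoc, smul_eq_mul] at h1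
    rw [intervalIntegral.integral_const_mul, ← hps s] at h1
    rw [pow_succ', mul_assoc, h1]
    field_simp
  have hd := (intervalIntegral.integral_hasDerivAt_right (hg.intervalIntegrable 0 s)
    (hg.stronglyMeasurableAtFilter _ _) hg.continuousAt).div (hasDerivAt_pow n s)
    (pow_pos hs n).ne'
  have hev : (fun s => s * p s) =ᶠ[𝓝 s]
      ((fun u => ∫ σ in (0 : ℝ)..u, σ ^ n * N σ (p σ)) / fun x => x ^ n) := by
    filter_upwards [lt_mem_nhds hs] with t ht
    have : t ^ n ≠ 0 := (pow_pos ht n).ne'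
    simp only [Pi.div_apply]
    rw [← hI t ht]
    field_simp
    ring
  refine (hd.congr_of_eventuallyEq hev).congr_deriv ?_
  rw [← hI s hs]
  have hp0 : p s ≠ 0 := (hκ.trans_le (hpκ s)).ne'
  have hNs : N s (p s) = m s / p s - c + n * p s := by simp only [N, max_eq_right (hpκ s)]
  rw [hNs, hn]
  simp only [Nat.add_sub_cancel]
  field_simp
  ring

/-- A function with values in `[κ, K]`, `κ > 0`, is the velocity of a global motion on the line. -/
theorem exists_global_motion {g : ℝ → ℝ} (hg : Continuous g) {κ K : ℝ} (hκ : 0 < κ)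
    (hlow : ∀ y, κ ≤ g y) (hup : ∀ y, g y ≤ K) :
    ∃ Y : ℝ → ℝ, Y 0 = 0 ∧ StrictMono Y ∧ Tendsto Y atTop atTop ∧
      ∀ t, HasDerivAt Y (g (Y t)) t := by
  have hpos : ∀ y, 0 < g y := fun y => hκ.trans_le (hlow y)
  have hK : 0 < K := (hpos 0).trans_le (hup 0)
  have hgi : Continuous fun y => (g y)⁻¹ := hg.inv₀ fun y => (hpos y).ne'
  -- `T y` is the time needed to travel from `0` to `y`; the motion is its inverse.
  let T : ℝ → ℝ := fun y => ∫ x in (0 : ℝ)..y, (g x)⁻¹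
  have hT : ∀ y, HasDerivAt T (g y)⁻¹ y := fun y =>
    intervalIntegral.integral_hasDerivAt_right (hgi.intervalIntegrable 0 y)
      (hgi.stronglyMeasurableAtFilter _ _) hgi.continuousAt
  have hTc : Continuous T := continuous_iff_continuousAt.2 fun y => (hT y).continuousAt
  have hT0 : T 0 = 0 := intervalIntegral.integral_same
  have hmono : StrictMono T := strictMono_of_deriv_pos fun y => by
    rw [(hT y).deriv]
    exact inv_pos.2 (hpos y)
  have hdiff : Monotone fun y => T y - K⁻¹ * y := by
    have hd : ∀ y, HasDerivAt (fun y => T y - K⁻¹ * y) ((g y)⁻¹ - K⁻¹ * 1) y := fun y =>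
      (hT y).sub ((hasDerivAt_id y).const_mul K⁻¹)
    refine monotone_of_deriv_nonneg (fun y => (hd y).differentiableAt) fun y => ?_
    rw [(hd y).deriv]
    simpa using inv_anti₀ (hpos y) (hup y)
  have hsurj : Function.Surjective T := by
    refine hTc.surjective ?_ ?_
    · refine tendsto_atTop_mono' _ ?_ (tendsto_id.const_mul_atTop (inv_pos.2 hK))
      filter_upwards [eventually_ge_atTop 0] with y hy
      have := hdiff hy
      simp only [hT0, mul_zero, sub_zero] at this
      simpa using this
    · refine tendsto_atBot_mono' _ ?_ (tendsto_id.const_mul_atBot (inv_pos.2 hK))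
      filter_upwards [eventually_le_atBot 0] with y hy
      have := hdiff hy
      simp only [hT0, mul_zero, sub_zero] at this
      simpa using this
  let e := StrictMono.orderIsoOfSurjective T hmono hsurj
  have he : ∀ t, T (e.symm t) = t := fun t => e.apply_symm_apply t
  refine ⟨e.symm, ?_, e.symm.strictMono, e.symm.tendsto_atTop, fun t => ?_⟩
  · rw [OrderIso.symm_apply_eq]
    exact hT0.symm
  · have := HasDerivAt.of_local_left_inverse e.symm.continuous.continuousAt (hT (e.symm t))
      (inv_ne_zero (hpos _).ne') (Eventually.of_forall he)
    rwa [inv_inv] at this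

/-- Existence of the stable separatrix as a graph over the distance `s` to the equilibrium. -/
theorem exists_separatrix_graph {F m : ℝ → ℝ} (hm : Continuous m) {m₀ M c a θp : ℝ}
    (hm₀ : 0 < m₀) (hlow : ∀ s, m₀ ≤ m s) (hup : ∀ s, m s ≤ M) (hc : 0 < c) (ha : 0 < a)
    (hF : ∀ s ∈ Ioc 0 a, F (θp - s) = s * m s) :
    ∃ v : ℝ → ℝ, (∀ s ∈ Ioc 0 a, 0 < v s ∧ HasDerivAt v (F (θp - s) / v s - c) s) ∧
      Tendsto v (𝓝[>] 0) (𝓝 0) ∧ (θp - a, v a) ∈ stableSeparatrix F c (θp - a) θp := by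
  obtain ⟨κ, hκ, p, hpκ, hp⟩ := exists_singular_profile hm hm₀ hlow hup hc
  have hp0 : ∀ s, 0 < p s := fun s => hκ.trans_le (hpκ s)
  have hquot : ∀ s ∈ Ioc 0 a, F (θp - s) / (s * p s) = m s / p s := fun s hs => by
    rw [hF s hs, mul_div_mul_left _ _ hs.1.ne']
  obtain ⟨Y, hY0, hYmono, hYtop, hY⟩ := exists_global_motion
    (g := fun y => p (a * Real.exp (-y))) (by fun_prop) hκ (fun y => hpκ _)
    (fun y => (le_abs_self _).trans (p.norm_coe_le_norm _))
  -- Along a trajectory `S' = -S p(S)`; the substitution `S = a e^{-Y}` makes the speed of `Y`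
  -- bounded and bounded away from zero.
  let S : ℝ → ℝ := fun t => a * Real.exp (-Y t)
  have hS : ∀ t, HasDerivAt S (-(S t * p (S t))) t := fun t => by
    refine (((hY t).neg.exp).const_mul a).congr_deriv ?_
    simp only [S, Pi.neg_apply]
    ring
  have hS0 : S 0 = a := by simp [S, hY0]
  have hSmem : ∀ t, 0 ≤ t → S t ∈ Ioc 0 a := fun t ht => by
    refine ⟨by positivity, mul_le_of_le_one_right ha.le (Real.exp_le_one_iff.2 ?_)⟩
    have := hYmono.monotone ht
    linarith
  have hSlim : Tendsto S atTop (𝓝 0) := by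
    have := (Real.tendsto_exp_neg_atTop_nhds_zero.comp hYtop).const_mul a
    rwa [mul_zero] at this
  have hvlim : Tendsto (fun s => s * p s) (𝓝 0) (𝓝 0) := by
    have : Continuous fun s => s * p s := by fun_prop
    simpa using this.tendsto 0
  refine ⟨fun s => s * p s, fun s hs => ⟨mul_pos hs.1 (hp0 s), ?_⟩,
    hvlim.mono_left nhdsWithin_le_nhds, ?_⟩
  · rw [hquot s hs]
    exact hp s hs.1
  · refine ⟨fun t => θp - S t, fun t => S t * p (S t), fun t ht => ⟨?_, ?_⟩, ?_, ?_, ?_, ?_⟩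
    · exact (((hS t).const_sub θp).congr_deriv (neg_neg _)).hasDerivWithinAt
    · have h := (hp _ (hSmem t ht).1).comp t (hS t)
      refine (h.congr_deriv ?_).hasDerivWithinAt
      have := (hp0 (S t)).ne'
      rw [hF _ (hSmem t ht)]
      field_simp
      ring
    · simp only [hS0]
    · intro t ht
      have := hSmem t ht
      exact ⟨⟨by linarith [this.2], by linarith [this.1]⟩, (mul_pos this.1 (hp0 _)).le⟩
    · simpa using hSlim.const_sub θp
    · exact hvlim.comp hSlim

/-! ### Uniqueness and comparison of separatrices. -/

/-- The separatrix meets each vertical line of the strip at most once. -/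
theorem stableSeparatrix_unique {F : ℝ → ℝ} {c x θhl θp w₁ w₂ : ℝ} (hc : 0 < c)
    (hF : AntitoneOn F (Icc θhl θp)) (h₁ : (x, w₁) ∈ stableSeparatrix F c θhl θp)
    (h₂ : (x, w₂) ∈ stableSeparatrix F c θhl θp) : w₁ = w₂ := by
  obtain ⟨u, v, huv, h0, hs, hu, hv⟩ := h₁
  obtain ⟨u', v', huv', h0', hs', hu', hv'⟩ := h₂
  simp only [Prod.mk.injEq] at h0 h0'
  -- The weight `e^{-ct}` cancels the term `c v`, and `F` antitone makes `P` nondecreasing. Since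
  -- `P` is `0` initially and at infinity, it vanishes identically; its derivative at `0` is the
  -- squared difference of the initial velocities.
  let P : ℝ → ℝ := fun t => Real.exp (-c * t) * ((u t - u' t) * (v t - v' t))
  have hP : ∀ t, 0 ≤ t → HasDerivWithinAt P (Real.exp (-c * t) *
      ((v t - v' t) ^ 2 - (u t - u' t) * (F (u t) - F (u' t)))) (Ici 0) t := by
    intro t ht
    have he : HasDerivAt (fun t => Real.exp (-c * t)) (Real.exp (-c * t) * (-c * 1)) t :=
      ((hasDerivAt_id t).const_mul (-c)).exp
    refine (he.hasDerivWithinAt.mul (((huv t ht).1.sub (huv' t ht).1).mul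
      ((huv t ht).2.sub (huv' t ht).2))).congr_deriv ?_
    simp only [Pi.sub_apply, Pi.mul_apply]
    ring
  have hnn : ∀ t, 0 ≤ t → (u t - u' t) * (F (u t) - F (u' t)) ≤ 0 := by
    intro t ht
    rcases le_total (u t) (u' t) with h | h
    · exact mul_nonpos_of_nonpos_of_nonneg (sub_nonpos.2 h)
        (sub_nonneg.2 (hF (hs t ht).1 (hs' t ht).1 h))
    · exact mul_nonpos_of_nonneg_of_nonpos (sub_nonneg.2 h)
        (sub_nonpos.2 (hF (hs' t ht).1 (hs t ht).1 h))
  have hmono : MonotoneOn P (Ici 0) := by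
    refine monotoneOn_of_hasDerivWithinAt_nonneg (convex_Ici 0)
      (fun t ht => (hP t ht).continuousWithinAt)
      (fun t ht => (hP t (interior_subset ht)).mono interior_subset) fun t ht => ?_
    have := hnn t (interior_subset ht)
    have := sq_nonneg (v t - v' t)
    have := Real.exp_pos (-c * t)
    nlinarith
  have hP0 : P 0 = 0 := by simp [P, h0.1, h0'.1]
  have hPlim : Tendsto P atTop (𝓝 0) := by
    have he : Tendsto (fun t : ℝ => Real.exp (-c * t)) atTop (𝓝 0) :=
      Real.tendsto_exp_atBot.comp (tendsto_id.const_mul_atTop_of_neg (neg_lt_zero.2 hc))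
    simpa [P] using he.mul ((hu.sub hu').mul (hv.sub hv'))
  have hPz : ∀ t ∈ Ici (0 : ℝ), P t = 0 := by
    intro t ht
    refine le_antisymm (ge_of_tendsto hPlim ?_) ?_
    · filter_upwards [eventually_ge_atTop t] with r hr
      exact hmono ht (mem_Ici.2 (le_trans ht hr)) hr
    · rw [← hP0]
      exact hmono self_mem_Ici ht ht
  have hd0 : HasDerivWithinAt P 0 (Ici 0) 0 :=
    (hasDerivWithinAt_const 0 (Ici 0) (0 : ℝ)).congr hPz (hPz 0 self_mem_Ici)
  have := (uniqueDiffOn_Ici (0 : ℝ) 0 self_mem_Ici).eq_deriv _ (hP 0 le_rfl) hd0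
  simp only [h0.1, h0'.1, h0.2, h0'.2, mul_zero, Real.exp_zero, one_mul, sub_self,
    sub_zero] at this
  exact sub_eq_zero.1 (pow_eq_zero_iff two_ne_zero |>.1 this)

/-- A function vanishing at `0+` which decreases wherever it is positive is nonpositive. -/
theorem nonpos_of_deriv_nonpos_of_pos {D D' : ℝ → ℝ} {a : ℝ} (ha : 0 < a)
    (hD : ∀ s ∈ Ioc 0 a, HasDerivAt D (D' s) s) (hlim : Tendsto D (𝓝[>] 0) (𝓝 0))
    (hneg : ∀ s ∈ Ioc 0 a, 0 < D s → D' s ≤ 0) : D a ≤ 0 := by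
  by_contra! hpos
  obtain ⟨s₀, hs₀D, hs₀⟩ := ((hlim.eventually (gt_mem_nhds (half_pos hpos))).and
    (Ioc_mem_nhdsGT ha)).exists
  have hcont : ContinuousOn D (Icc s₀ a) := fun s hs =>
    (hD s ⟨hs₀.1.trans_le hs.1, hs.2⟩).continuousAt.continuousWithinAt
  have hcompact : IsCompact (Icc s₀ a ∩ D ⁻¹' Iic (D a / 2)) :=
    isCompact_Icc.of_isClosed_subset (hcont.preimage_isClosed_of_isClosed isClosed_Icc isClosed_Iic)
      inter_subset_left
  -- The last point with `D ≤ D a / 2`: beyond it `D` is positive, hence nonincreasing, and cannot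
  -- climb to `D a`.
  obtain ⟨s₁, ⟨hs₁, hs₁D⟩, hmax⟩ :=
    hcompact.exists_isGreatest ⟨s₀, left_mem_Icc.2 hs₀.2, hs₀D.le⟩
  have hanti : AntitoneOn D (Icc s₁ a) := by
    refine antitoneOn_of_deriv_nonpos (convex_Icc _ _) (hcont.mono (Icc_subset_Icc_left hs₁.1))
      (fun s hs => ?_) fun s hs => ?_
    all_goals
      rw [interior_Icc] at hs
      have hs' : s ∈ Ioc 0 a := ⟨hs₀.1.trans_le (hs₁.1.trans hs.1.le), hs.2.le⟩
    · exact (hD s hs').differentiableAt.differentiableWithinAt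
    · rw [(hD s hs').deriv]
      refine hneg s hs' ?_
      by_contra! h
      exact hs.1.not_ge (hmax ⟨⟨hs₁.1.trans hs.1.le, hs.2.le⟩, h.trans (half_pos hpos).le⟩)
  have h1 := hanti (left_mem_Icc.2 hs₁.2) (right_mem_Icc.2 hs₁.2) hs₁.2
  have h2 : D s₁ ≤ D a / 2 := hs₁D
  linarith

/-- Comparison of two separatrices. -/
theorem separatrix_comparison {f v₁ v₂ : ℝ → ℝ} {c₁ c₂ a : ℝ} (ha : 0 < a) (hc : c₁ ≤ c₂)
    (hf : ∀ s ∈ Ioc 0 a, 0 ≤ f s)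
    (h₁ : ∀ s ∈ Ioc 0 a, 0 < v₁ s ∧ HasDerivAt v₁ (f s / v₁ s - c₁) s)
    (h₂ : ∀ s ∈ Ioc 0 a, 0 < v₂ s ∧ HasDerivAt v₂ (f s / v₂ s - c₂) s)
    (l₁ : Tendsto v₁ (𝓝[>] 0) (𝓝 0)) (l₂ : Tendsto v₂ (𝓝[>] 0) (𝓝 0)) :
    v₂ a ≤ v₁ a ∧ v₁ a - v₂ a ≤ (c₂ - c₁) * a := by
  constructor
  · have := nonpos_of_deriv_nonpos_of_pos (D := fun s => v₂ s - v₁ s) ha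
      (fun s hs => (h₂ s hs).2.sub (h₁ s hs).2) (by simpa using l₂.sub l₁) fun s hs hpos => by
        have := div_le_div_of_nonneg_left (hf s hs) (h₁ s hs).1 (sub_pos.1 hpos).le
        linarith
    linarith
  · have hl : Tendsto (fun s : ℝ => (c₂ - c₁) * s) (𝓝[>] 0) (𝓝 0) := by
      have : Continuous fun s : ℝ => (c₂ - c₁) * s := by fun_prop
      simpa using (this.tendsto 0).mono_left nhdsWithin_le_nhds
    have := nonpos_of_deriv_nonpos_of_pos (D := fun s => v₁ s - v₂ s - (c₂ - c₁) * s) ha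
      (fun s hs => ((h₁ s hs).2.sub (h₂ s hs).2).sub ((hasDerivAt_id s).const_mul (c₂ - c₁)))
      (by simpa using (l₁.sub l₂).sub hl) fun s hs hpos => by
        have h3 : v₂ s ≤ v₁ s := by
          have := mul_nonneg (sub_nonneg.2 hc) hs.1.le
          linarith
        have := div_le_div_of_nonneg_left (hf s hs) (h₂ s hs).1 h3
        linarith
    linarith

/-! ### Monotone inverses and the level set of `G`. -/

/-- A continuous strictly increasing function has a continuous strictly increasing inverse. -/
theorem exists_continuousOn_inverse {r : ℝ → ℝ} {s t : Set ℝ} [s.OrdConnected] [t.OrdConnected]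
    (hr : StrictMonoOn r s) (ht : r '' s = t) :
    ∃ X : ℝ → ℝ, StrictMonoOn X t ∧ ContinuousOn X t ∧ MapsTo X t s ∧
      (∀ x ∈ s, X (r x) = x) ∧ ∀ y ∈ t, r (X y) = y := by
  subst ht
  classical
  let e := hr.orderIso r s
  have hX : ∀ y (hy : y ∈ r '' s),
      (fun y => if h : y ∈ r '' s then (e.symm ⟨y, h⟩ : ℝ) else 0) y = e.symm ⟨y, hy⟩ :=
    fun y hy => dif_pos hy
  refine ⟨fun y => if h : y ∈ r '' s then (e.symm ⟨y, h⟩ : ℝ) else 0, ?_, ?_, ?_, ?_, ?_⟩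
  · intro y hy z hz hyz
    rw [hX y hy, hX z hz]
    exact e.symm.strictMono hyz
  -- On order-connected sets the subspace topology is the order topology, so an order isomorphism is
  -- continuous; continuity of `r` is not needed.
  · rw [continuousOn_iff_continuous_domRestrict]
    refine (continuous_subtype_val.comp e.symm.continuous).congr fun y => ?_
    exact (hX y y.2).symm
  · intro y hy
    rw [hX y hy]
    exact (e.symm ⟨y, hy⟩).2
  · intro x hx
    rw [hX _ (mem_image_of_mem r hx)]
    exact congrArg Subtype.val (e.symm_apply_apply ⟨x, hx⟩)
  · intro y hy
    rw [hX y hy]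
    exact congrArg Subtype.val (e.apply_symm_apply ⟨y, hy⟩)

section Transcendental

variable {α β : ℝ}

/-- The function is strictly concave and vanishes at `0`. -/
theorem mul_one_sub_exp_neg_sub_pos (hβ : 0 < β) {x y : ℝ} (hx : 0 < x) (hxy : x < y)
    (hy : 0 ≤ β * (1 - Real.exp (-y)) - α * y) : 0 < β * (1 - Real.exp (-x)) - α * x := by
  have hy0 := hx.trans hxy
  have h := strictConvexOn_exp.2 (mem_univ (-y)) (mem_univ 0) (by linarith : -y ≠ 0)
    (div_pos hx hy0) (sub_pos.2 ((div_lt_one hy0).2 hxy)) (by ring)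
  simp only [smul_eq_mul, mul_zero, add_zero, Real.exp_zero, mul_one] at h
  rw [show x / y * -y = -x by field_simp] at h
  have h1 := mul_nonneg (div_pos hx hy0).le hy
  have h2 : x / y * (β * (1 - Real.exp (-y)) - α * y) =
      β * (x / y * (1 - Real.exp (-y))) - α * x := by field_simp
  rw [h2] at h1
  have h3 := mul_lt_mul_of_pos_left h hβ
  nlinarith

/-- Intermediate values between `log (β / α)`, where `log t < t - 1` gives positivity, and `β / α`,
where the value is `-β e^{-β/α}`. -/
theorem exists_zero_mul_one_sub_exp_neg (hα : 0 < α) (hαβ : α < β) :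
    ∃ y, Real.log (β / α) < y ∧ β * (1 - Real.exp (-y)) - α * y = 0 := by
  have hβ : 0 < β := hα.trans hαβ
  have h1 : 1 < β / α := (one_lt_div hα).2 hαβ
  have hlog := Real.log_lt_sub_one_of_pos (zero_lt_one.trans h1) h1.ne'
  have ha : 0 < β * (1 - Real.exp (-Real.log (β / α))) - α * Real.log (β / α) := by
    rw [Real.exp_neg, Real.exp_log (by positivity)]
    have := mul_lt_mul_of_pos_left hlog hα
    have e : α * (β / α - 1) = β * (1 - (β / α)⁻¹) := by field_simp
    linarith
  have hb : β * (1 - Real.exp (-(β / α))) - α * (β / α) < 0 := by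
    have := mul_pos hβ (Real.exp_pos (-(β / α)))
    have e : α * (β / α) = β := by field_simp
    linarith
  have hle : Real.log (β / α) ≤ β / α := by linarith
  obtain ⟨y, hy, hy0⟩ := intermediate_value_Icc' hle
    (f := fun y => β * (1 - Real.exp (-y)) - α * y) (by fun_prop) ⟨hb.le, ha.le⟩
  refine ⟨y, lt_of_le_of_ne hy.1 ?_, hy0⟩
  rintro rfl
  exact ha.ne' hy0

theorem exp_sub_one_sub_pos {x : ℝ} (hx : 0 < x) : 0 < Real.exp x - 1 - x := by
  linarith [Real.add_one_lt_exp hx.ne']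

theorem mul_exp_sub_pos_iff (hα : 0 < α) (hβ : 0 < β) {x : ℝ} :
    0 < α * Real.exp x - β ↔ Real.log (β / α) < x := by
  rw [Real.log_lt_iff_lt_exp (by positivity), div_lt_iff₀ hα, sub_pos, mul_comm]

/-- The square of the speed along the level set, divided by `q`, as a function of `x = c R`. -/
noncomputable def speedSq (α β x : ℝ) : ℝ := (Real.exp x - 1 - x) / (α * Real.exp x - β)

theorem speedSq_pos (hα : 0 < α) (hαβ : α < β) {x : ℝ} (hx : Real.log (β / α) < x) :
    0 < speedSq α β x :=
  div_pos (exp_sub_one_sub_pos ((Real.log_pos ((one_lt_div hα).2 hαβ)).trans hx))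
    ((mul_exp_sub_pos_iff hα (hα.trans hαβ)).2 hx)

theorem hasDerivAt_speedSq (hα : 0 < α) (hβ : 0 < β) {x : ℝ} (hx : Real.log (β / α) < x) :
    HasDerivAt (speedSq α β)
      (-(Real.exp x * (β * (1 - Real.exp (-x)) - α * x)) / (α * Real.exp x - β) ^ 2) x := by
  have hd := (((Real.hasDerivAt_exp x).sub_const 1).sub (hasDerivAt_id x)).div
    (((Real.hasDerivAt_exp x).const_mul α).sub_const β) ((mul_exp_sub_pos_iff hα hβ).2 hx).ne'
  refine hd.congr_deriv ?_
  congr 1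
  have := Real.exp_ne_zero x
  simp only [Pi.sub_apply, id, Real.exp_neg]
  field_simp
  ring

theorem continuousOn_speedSq (hα : 0 < α) (hβ : 0 < β) :
    ContinuousOn (speedSq α β) (Ioi (Real.log (β / α))) := fun _ hx =>
  (hasDerivAt_speedSq hα hβ hx).continuousAt.continuousWithinAt

theorem strictAntiOn_speedSq (hα : 0 < α) (hαβ : α < β) {y : ℝ}
    (hy : β * (1 - Real.exp (-y)) - α * y = 0) :
    StrictAntiOn (speedSq α β) (Ioc (Real.log (β / α)) y) := by
  have hβ := hα.trans hαβ
  refine strictAntiOn_of_deriv_neg (convex_Ioc _ _)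
    ((continuousOn_speedSq hα hβ).mono Ioc_subset_Ioi_self) fun x hx => ?_
  rw [interior_Ioc] at hx
  rw [(hasDerivAt_speedSq hα hβ hx.1).deriv, neg_div, neg_lt_zero]
  have h0 := (Real.log_pos ((one_lt_div hα).2 hαβ)).trans hx.1
  have := mul_one_sub_exp_neg_sub_pos hβ h0 hx.2 hy.ge
  have := (mul_exp_sub_pos_iff hα hβ).2 hx.1
  positivity

theorem tendsto_speedSq (hα : 0 < α) (hαβ : α < β) :
    Tendsto (speedSq α β) (𝓝[>] Real.log (β / α)) atTop := by
  have hβ := hα.trans hαβ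
  have h1 : Tendsto (fun x => Real.exp x - 1 - x) (𝓝[>] Real.log (β / α))
      (𝓝 (Real.exp (Real.log (β / α)) - 1 - Real.log (β / α))) :=
    ((by fun_prop : Continuous fun x : ℝ => Real.exp x - 1 - x).tendsto _).mono_left
      nhdsWithin_le_nhds
  have h2 : Tendsto (fun x => α * Real.exp x - β) (𝓝[>] Real.log (β / α)) (𝓝[>] 0) := by
    refine tendsto_nhdsWithin_iff.2 ⟨?_, ?_⟩
    · have := (by fun_prop : Continuous fun x : ℝ => α * Real.exp x - β).tendsto
        (Real.log (β / α))
      rw [Real.exp_log (by positivity), mul_div_cancel₀ _ hα.ne', sub_self] at this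
      exact this.mono_left nhdsWithin_le_nhds
    · filter_upwards [self_mem_nhdsWithin] with x hx
      exact (mul_exp_sub_pos_iff hα hβ).2 hx
  exact h1.pos_mul_atTop (exp_sub_one_sub_pos (Real.log_pos ((one_lt_div hα).2 hαβ)))
    (tendsto_inv_nhdsGT_zero.comp h2)

/-- The level set in terms of `x = c R`. -/
theorem mem_phiCurve_iff {q : ℝ} (hq : 0 < q) (hα : 0 < α) (hαβ : α < β) {y : ℝ}
    (hy0 : Real.log (β / α) < y) (hy : β * (1 - Real.exp (-y)) - α * y = 0) (R c : ℝ) :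
    (R, c) ∈ phiCurve q α β ↔ 0 < R ∧ 0 < c ∧ c * R ∈ Ioc (Real.log (β / α)) y ∧
      c ^ 2 = q * speedSq α β (c * R) := by
  have hβ := hα.trans hαβ
  have hl := Real.log_pos ((one_lt_div hα).2 hαβ)
  -- With `c ^ 2 = q * speedSq α β x`, the left side is `c ≥ q R / β` multiplied by `β * c`.
  have key : ∀ x, Real.log (β / α) < x → (q * x ≤ β * (q * speedSq α β x) ↔ x ≤ y) := by
    intro x hx
    have hD := (mul_exp_sub_pos_iff hα hβ).2 hx
    have h1 : q * x ≤ β * (q * speedSq α β x) ↔ 0 ≤ β * (1 - Real.exp (-x)) - α * x := by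
      have e : β * (q * speedSq α β x) - q * x =
          q * Real.exp x / (α * Real.exp x - β) * (β * (1 - Real.exp (-x)) - α * x) := by
        obtain ⟨D, hDe⟩ : ∃ D, D = α * Real.exp x - β := ⟨_, rfl⟩
        have hE := Real.exp_ne_zero x
        rw [speedSq, Real.exp_neg, ← hDe]
        rw [← hDe] at hD
        field_simp
        rw [hDe]
        ring
      rw [← sub_nonneg, e, mul_nonneg_iff_of_pos_left (by positivity)]
    rw [h1]
    constructor
    · intro h
      by_contra! hlt
      exact (mul_one_sub_exp_neg_sub_pos hβ (hl.trans hy0) hlt h).ne' hy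
    · intro h
      rcases h.lt_or_eq with h | rfl
      · exact (mul_one_sub_exp_neg_sub_pos hβ (hl.trans hx) h hy.ge).le
      · exact hy.ge
  simp only [phiCurve, Qplus, transG, mem_ofPred_eq]
  constructor
  · rintro ⟨⟨hR, hc⟩, hG⟩
    have hc0 : 0 < c := lt_of_lt_of_le (by positivity) hc
    have hx0 : 0 < c * R := by positivity
    have hpos := mul_pos (exp_sub_one_sub_pos hx0) hq
    have hD : 0 < α * Real.exp (c * R) - β := by
      refine pos_of_mul_pos_right (a := c ^ 2) ?_ (by positivity)
      linarith
    have hx := (mul_exp_sub_pos_iff hα hβ).1 hD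
    have hcs : c ^ 2 = q * speedSq α β (c * R) := by
      rw [speedSq, mul_div_assoc', eq_div_iff hD.ne']
      linarith
    refine ⟨hR, hc0, ⟨hx, (key _ hx).1 ?_⟩, hcs⟩
    rw [← hcs]
    rw [div_le_iff₀ hβ] at hc
    nlinarith
  · rintro ⟨hR, hc, ⟨hx, hxy⟩, hcs⟩
    have hk := (key _ hx).2 hxy
    rw [← hcs] at hk
    have hD := (mul_exp_sub_pos_iff hα hβ).2 hx
    refine ⟨⟨hR, ?_⟩, ?_⟩
    · rw [div_le_iff₀ hβ]
      refine le_of_mul_le_mul_left ?_ hc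
      linarith
    · rw [speedSq, mul_div_assoc', eq_div_iff hD.ne'] at hcs
      linarith

/-- The level set is the graph of a continuous, strictly decreasing function. -/
theorem exists_phi {q : ℝ} (hq : 0 < q) (hα : 0 < α) (hαβ : α < β) :
    ∃ (R₀ : ℝ) (φ : ℝ → ℝ), 0 < R₀ ∧ phiCurve q α β = (Ioc 0 R₀).graphOn φ ∧
      ContinuousOn φ (Ioc 0 R₀) ∧ StrictAntiOn φ (Ioc 0 R₀) ∧ φ R₀ = q * R₀ / β ∧
      Tendsto φ (𝓝[>] 0) atTop := by
  have hβ := hα.trans hαβ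
  obtain ⟨y, hy0, hy⟩ := exists_zero_mul_one_sub_exp_neg hα hαβ
  have hmem := mem_phiCurve_iff hq hα hαβ hy0 hy
  have hanti := strictAntiOn_speedSq hα hαβ hy
  have hcont : ContinuousOn (speedSq α β) (Ioc (Real.log (β / α)) y) :=
    (continuousOn_speedSq hα hβ).mono Ioc_subset_Ioi_self
  have htend := tendsto_speedSq hα hαβ
  have hpos : ∀ x ∈ Ioc (Real.log (β / α)) y, 0 < speedSq α β x := fun x hx =>
    speedSq_pos hα hαβ hx.1
  have hl := Real.log_pos ((one_lt_div hα).2 hαβ)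
  have hyend : β * speedSq α β y = y := by
    have hD := ((mul_exp_sub_pos_iff hα hβ).2 hy0).ne'
    rw [speedSq, mul_div_assoc', div_eq_iff hD]
    have : β * (Real.exp y * (1 - Real.exp (-y))) = Real.exp y * (α * y) := by
      rw [mul_left_comm]; congr 1; linarith
    rw [mul_sub, ← Real.exp_add, add_neg_cancel, Real.exp_zero] at this
    linarith
  set l := Real.log (β / α)
  let C : ℝ → ℝ := fun x => Real.sqrt (q * speedSq α β x)
  have hCpos : ∀ x ∈ Ioc l y, 0 < C x := fun x hx => Real.sqrt_pos.2 (mul_pos hq (hpos x hx))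
  have hCsq : ∀ x ∈ Ioc l y, C x ^ 2 = q * speedSq α β x := fun x hx =>
    Real.sq_sqrt (mul_pos hq (hpos x hx)).le
  have hCcont : ContinuousOn C (Ioc l y) := (hcont.const_mul q).sqrt
  have hCanti : StrictAntiOn C (Ioc l y) := fun a ha b hb hab =>
    Real.sqrt_lt_sqrt (mul_pos hq (hpos b hb)).le (mul_lt_mul_of_pos_left (hanti ha hb hab) hq)
  have hCtend : Tendsto C (𝓝[>] l) atTop :=
    Real.tendsto_sqrt_atTop.comp (htend.const_mul_atTop hq)
  -- `x ↦ (r x, C x)` parametrizes the level set by `x = c R`; thus `φ = C ∘ r⁻¹` and `R₀ = r y`.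
  let r : ℝ → ℝ := fun x => x / C x
  have hrpos : ∀ x ∈ Ioc l y, 0 < r x := fun x hx => div_pos (hl.trans hx.1) (hCpos x hx)
  have hrmono : StrictMonoOn r (Ioc l y) := fun a ha b hb hab =>
    div_lt_div₀ hab (hCanti ha hb hab).le (hl.trans hb.1).le (hCpos b hb)
  have hrcont : ContinuousOn r (Ioc l y) :=
    continuousOn_id.div hCcont fun x hx => (hCpos x hx).ne'
  have hrtend : Tendsto r (𝓝[>] l) (𝓝 0) :=
    (tendsto_nhdsWithin_of_tendsto_nhds tendsto_id).div_atTop hCtend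
  have hyI : y ∈ Ioc l y := ⟨hy0, le_rfl⟩
  have himage : r '' Ioc l y = Ioc 0 (r y) := by
    apply Subset.antisymm
    · rintro _ ⟨x, hx, rfl⟩
      exact ⟨hrpos x hx, hrmono.monotoneOn hx hyI hx.2⟩
    · intro z hz
      obtain ⟨x, hxz, hx⟩ := ((hrtend.eventually (gt_mem_nhds hz.1)).and
        (Ioc_mem_nhdsGT hy0)).exists
      obtain ⟨w, hw, rfl⟩ := intermediate_value_Icc hx.2
        (hrcont.mono fun w hw => ⟨hx.1.trans_le hw.1, hw.2⟩) ⟨hxz.le, hz.2⟩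
      exact ⟨w, ⟨hx.1.trans_le hw.1, hw.2⟩, rfl⟩
  obtain ⟨X, hXmono, hXcont, hXmaps, hXr, hrX⟩ := exists_continuousOn_inverse hrmono himage
  have hRy : r y ∈ Ioc 0 (r y) := ⟨hrpos y hyI, le_rfl⟩
  refine ⟨r y, C ∘ X, hrpos y hyI, ?_, hCcont.comp hXcont hXmaps,
    fun a ha b hb hab => hCanti (hXmaps ha) (hXmaps hb) (hXmono ha hb hab), ?_, ?_⟩
  · ext ⟨R, c⟩
    rw [hmem, mem_graphOn]
    constructor
    · rintro ⟨hR, hc, hx, hcs⟩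
      have hCc : C (c * R) = c := by
        simp only [C]
        rw [← hcs, Real.sqrt_sq hc.le]
      have hrc : r (c * R) = R := by
        simp only [r]
        rw [hCc, mul_div_cancel_left₀ _ hc.ne']
      have hXR : X R = c * R := by rw [← hXr _ hx, hrc]
      refine ⟨?_, ?_⟩
      · rw [← himage]
        exact ⟨_, hx, hrc⟩
      · simp only [Function.comp_apply, hXR, hCc]
    · simp only
      rintro ⟨hR, rfl⟩
      have hx := hXmaps hR
      have hcR : (C ∘ X) R * R = X R := by
        have h1 := hrX R hR
        simp only [r] at h1
        rw [div_eq_iff (hCpos _ hx).ne'] at h1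
        simp only [Function.comp_apply]
        linarith
      rw [hcR]
      exact ⟨hR.1, hCpos _ hx, hx, hCsq _ hx⟩
  · simp only [Function.comp_apply]
    rw [hXr y hyI]
    simp only [r]
    have h1 := hCsq y hyI
    have h2 := hCpos y hyI
    field_simp
    rw [h1]
    linear_combination q * hyend
  · refine tendsto_atTop.2 fun b => ?_
    obtain ⟨x, hxb, hx⟩ := ((hCtend.eventually_ge_atTop b).and (Ioc_mem_nhdsGT hy0)).exists
    filter_upwards [Ioc_mem_nhdsGT (hrpos x hx)] with R hR
    have hRm : R ∈ Ioc 0 (r y) := ⟨hR.1, hR.2.trans (hrmono.monotoneOn hx hyI hx.2)⟩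
    have hXx : X R ≤ x := by
      rw [← hrmono.le_iff_le (hXmaps hRm) hx, hrX R hRm]
      exact hR.2
    exact hxb.trans (hCanti.antitoneOn (hXmaps hRm) hx hXx)

end Transcendental

/-! ### The nonlinearity `F` and the curve `ψ`. -/

theorem one_add_thetaPlus_pow {q h : ℝ} (hq : 0 < q) (hh : 0 < h) :
    (1 + thetaPlus q h) ^ 4 = 1 + q / h := by
  rw [thetaPlus, add_sub_cancel, ← Real.rpow_natCast, ← Real.rpow_mul (by positivity)]
  norm_num

theorem nonlinF_thetaPlus_sub {q h : ℝ} (hq : 0 < q) (hh : 0 < h) (s : ℝ) :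
    nonlinF q h (thetaPlus q h - s) = s * (h * (2 * (1 + thetaPlus q h) - s) *
      ((1 + thetaPlus q h) ^ 2 + (1 + thetaPlus q h - s) ^ 2)) := by
  have h1 := one_add_thetaPlus_pow hq hh
  have h2 : q = h * ((1 + thetaPlus q h) ^ 4 - 1) := by
    rw [h1]
    field_simp
    ring
  rw [nonlinF]
  nth_rw 1 [h2]
  ring

theorem antitoneOn_nonlinF {q h x y : ℝ} (hh : 0 < h) (hx : 0 ≤ x) :
    AntitoneOn (nonlinF q h) (Icc x y) := by
  intro a ha b _ hab
  have := hx.trans ha.1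
  unfold nonlinF
  gcongr

/-- For every speed the separatrix is a positive graph reaching the ignition line. -/
theorem exists_separatrix {q h θhl c : ℝ} (hq : 0 < q) (hh : 0 < h) (hθ : 0 < θhl)
    (hθp : θhl < thetaPlus q h) (hc : 0 < c) :
    ∃ v : ℝ → ℝ, (∀ s ∈ Ioc 0 (thetaPlus q h - θhl), 0 < v s ∧
        HasDerivAt v (nonlinF q h (thetaPlus q h - s) / v s - c) s) ∧
      Tendsto v (𝓝[>] 0) (𝓝 0) ∧
      (θhl, v (thetaPlus q h - θhl)) ∈
        stableSeparatrix (nonlinF q h) c θhl (thetaPlus q h) := by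
  have hF := nonlinF_thetaPlus_sub hq hh
  set θp := thetaPlus q h
  have ha : 0 < θp - θhl := sub_pos.2 hθp
  -- Clamping `s` to `[0, θp - θhl]` gives the cofactor of `s` in `F` global positive bounds without
  -- changing it on the strip.
  let k : ℝ → ℝ := fun s => max 0 (min s (θp - θhl))
  have hk0 : ∀ s, 0 ≤ k s := fun s => le_max_left _ _
  have hka : ∀ s, k s ≤ θp - θhl := fun s => max_le ha.le (min_le_right _ _)
  have hk : ∀ s ∈ Ioc 0 (θp - θhl), k s = s := fun s hs => by
    simp only [k, min_eq_left hs.2, max_eq_right hs.1.le]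
  have key := exists_separatrix_graph (F := nonlinF q h) (θp := θp) (a := θp - θhl) (c := c)
    (m := fun s => h * (2 * (1 + θp) - k s) * ((1 + θp) ^ 2 + (1 + θp - k s) ^ 2))
    (m₀ := h) (M := h * (2 * (1 + θp)) * ((1 + θp) ^ 2 + (1 + θp) ^ 2)) (by fun_prop) hh
    (fun s => ?_) (fun s => ?_) hc ha fun s hs => ?_
  · rwa [sub_sub_cancel] at key
  · have h1 : 1 ≤ 2 * (1 + θp) - k s := by linarith [hka s]
    have h2 : 1 ≤ (1 + θp) ^ 2 + (1 + θp - k s) ^ 2 := by nlinarith [sq_nonneg (1 + θp - k s)]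
    rw [mul_assoc]
    exact le_mul_of_one_le_right hh.le (one_le_mul_of_one_le_of_one_le h1 h2)
  · have h1 : 0 ≤ 1 + θp - k s := by linarith [hka s]
    have h2 : 0 < 1 + θp := by linarith
    gcongr
    · linarith [hk0 s]
    · linarith [hk0 s]
  · rw [hF s, hk s hs]

/-- The pairs for which the separatrix matches the boundary condition form the graph of a
continuous, strictly increasing function. -/
theorem exists_psi {q h θhl : ℝ} (hq : 0 < q) (hh : 0 < h) (hθ : 0 < θhl)
    (hθp : θhl < thetaPlus q h) :
    ∃ ψ : ℝ → ℝ, psiCurve q h θhl = (Ici 0).graphOn ψ ∧ ContinuousOn ψ (Ici 0) ∧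
      StrictMonoOn ψ (Ici 0) ∧ ∀ R, 0 ≤ R → q * R / θhl < ψ R := by
  have ha : 0 < thetaPlus q h - θhl := sub_pos.2 hθp
  choose! v hv hvlim hvS using fun (c : ℝ) (hc : 0 < c) => exists_separatrix hq hh hθ hθp hc
  set a := thetaPlus q h - θhl
  let V : ℝ → ℝ := fun c => v c a
  have hfpos : ∀ s ∈ Ioc 0 a, 0 ≤ nonlinF q h (thetaPlus q h - s) := by
    intro s hs
    rw [nonlinF_thetaPlus_sub hq hh]
    have h1 : 0 ≤ 2 * (1 + thetaPlus q h) - s := by linarith [hs.2]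
    have := hs.1.le
    positivity
  have hVpos : ∀ c, 0 < c → 0 < V c := fun c hc => (hv c hc a ⟨ha, le_rfl⟩).1
  have hcomp : ∀ c d, 0 < c → c ≤ d → V d ≤ V c ∧ V c - V d ≤ (d - c) * a := fun c d hc hcd =>
    have hd := hc.trans_le hcd
    separatrix_comparison ha hcd hfpos (hv c hc) (hv d hd) (hvlim c hc) (hvlim d hd)
  have hVcont : ContinuousOn V (Ioi 0) := by
    have : LipschitzOnWith ⟨a, ha.le⟩ V (Ioi 0) := by
      refine LipschitzOnWith.of_dist_le_mul fun c hc d hd => ?_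
      rw [Real.dist_eq, Real.dist_eq]
      change _ ≤ a * _
      rcases le_total c d with hcd | hcd
      · have := hcomp c d hc hcd
        rw [abs_of_nonneg (by linarith), abs_of_nonpos (by linarith)]
        linarith
      · have := hcomp d c hd hcd
        rw [abs_of_nonpos (by linarith), abs_of_nonneg (by linarith)]
        linarith
    exact this.continuousOn
  let r : ℝ → ℝ := fun c => (c * θhl - V c) / q
  have hrcont : ContinuousOn r (Ioi 0) := by
    have : ContinuousOn (fun c : ℝ => c * θhl) (Ioi 0) := by fun_prop
    exact (this.sub hVcont).div_const q
  have hrmono : StrictMonoOn r (Ioi 0) := by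
    intro c hc d hd hcd
    have h1 := (hcomp c d hc hcd.le).1
    have h2 := mul_lt_mul_of_pos_right hcd hθ
    exact div_lt_div_of_pos_right (by linarith) hq
  let J : Set ℝ := {c | 0 < c ∧ 0 ≤ r c}
  have hJ : J.OrdConnected := ⟨fun c hc d _ e he =>
    ⟨hc.1.trans_le he.1, hc.2.trans (hrmono.monotoneOn hc.1 (hc.1.trans_le he.1) he.1)⟩⟩
  have himage : r '' J = Ici 0 := by
    apply Subset.antisymm
    · rintro _ ⟨c, hc, rfl⟩
      exact hc.2
    · intro R hR
      have hR : 0 ≤ R := hR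
      have hV1 := hVpos 1 one_pos
      have hlo : ∃ c, 0 < c ∧ c ≤ 1 ∧ r c ≤ R := by
        -- Here `c θhl ≤ V 1 ≤ V c`, so `r c ≤ 0`.
        refine ⟨min 1 (V 1 / θhl), by positivity, min_le_left _ _, le_trans ?_ hR⟩
        have h1 := (hcomp (min 1 (V 1 / θhl)) 1 (by positivity) (min_le_left _ _)).1
        have h2 := min_le_right 1 (V 1 / θhl)
        rw [le_div_iff₀ hθ] at h2
        exact div_nonpos_of_nonpos_of_nonneg (by linarith) hq.le
      have hhi : ∃ d, 1 ≤ d ∧ R ≤ r d := by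
        -- Here `d θhl = θhl + q R + V 1` and `V d ≤ V 1`, so `r d ≥ R`.
        refine ⟨1 + (q * R + V 1) / θhl, le_add_of_nonneg_right (by positivity), ?_⟩
        have h0 : 0 ≤ (q * R + V 1) / θhl := by positivity
        have h1 := (hcomp 1 (1 + (q * R + V 1) / θhl) one_pos (by linarith)).1
        have h2 : (1 + (q * R + V 1) / θhl) * θhl = θhl + (q * R + V 1) := by field_simp
        simp only [r]
        rw [le_div_iff₀ hq, h2]
        linarith
      obtain ⟨c, hc, hc1, hcR⟩ := hlo
      obtain ⟨d, hd1, hdR⟩ := hhi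
      obtain ⟨e, he, rfl⟩ := intermediate_value_Icc (hc1.trans hd1)
        (hrcont.mono fun x hx => hc.trans_le hx.1) ⟨hcR, hdR⟩
      exact ⟨e, ⟨hc.trans_le he.1, hR⟩, rfl⟩
  obtain ⟨X, hXmono, hXcont, hXmaps, hXr, hrX⟩ :=
    exists_continuousOn_inverse (hrmono.mono fun c (hc : c ∈ J) => hc.1) himage
  refine ⟨X, ?_, hXcont, hXmono, fun R hR => ?_⟩
  · ext ⟨R, c⟩
    simp only [psiCurve, mem_ofPred_eq, mem_graphOn, mem_Ici]
    constructor
    · rintro ⟨hR, hc, hS⟩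
      have hVc : c * θhl - q * R = V c :=
        stableSeparatrix_unique hc (antitoneOn_nonlinF hh hθ.le) hS (hvS c hc)
      have hrc : r c = R := by
        simp only [r]
        rw [div_eq_iff hq.ne']
        linarith
      refine ⟨hR, ?_⟩
      rw [← hrc]
      exact hXr c ⟨hc, by rwa [hrc]⟩
    · rintro ⟨hR, rfl⟩
      have hc := (hXmaps hR).1
      have h1 := hrX R hR
      simp only [r] at h1
      rw [div_eq_iff hq.ne'] at h1
      refine ⟨hR, hc, ?_⟩
      rw [show X R * θhl - q * R = V (X R) by linarith]
      exact hvS _ hc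
  · have h1 := hrX R hR
    have h2 := hVpos _ (hXmaps hR).1
    simp only [r] at h1
    rw [div_eq_iff hq.ne'] at h1
    rw [div_lt_iff₀ hθ]
    linarith

/-! ### The unique crossing of the two curves. -/

theorem corollary5p1 (q h θig θhl : ℝ) (hq : 0 < q) (hh : 0 < h) (hig : 0 < θig)
    (hig_hl : θig < θhl) (hhl : θhl < thetaPlus q h) :
    ∃ (R₀ : ℝ) (φ ψ : ℝ → ℝ),
      -- the curve `φ` on `(0, R₀]`
      0 < R₀ ∧
      phiCurve q θig θhl = (Ioc 0 R₀).graphOn φ ∧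
      ContinuousOn φ (Ioc 0 R₀) ∧
      StrictAntiOn φ (Ioc 0 R₀) ∧
      φ R₀ = q * R₀ / θhl ∧
      Tendsto φ (𝓝[>] 0) atTop ∧
      -- the curve `ψ` on `[0, ∞)`
      psiCurve q h θhl = (Ici 0).graphOn ψ ∧
      ContinuousOn ψ (Ici 0) ∧
      StrictMonoOn ψ (Ici 0) ∧
      (∀ R, 0 ≤ R → q * R / θhl < ψ R) ∧
      -- the two curves have exactly one common point, and it is interior to `Q₊`
      ∃ Rs cs : ℝ, (Rs, cs) ∈ interior (Qplus q θhl) ∧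
        (Ioc 0 R₀).graphOn φ ∩ (Ici 0).graphOn ψ = {(Rs, cs)} := by
  have hθ := hig.trans hig_hl
  obtain ⟨R₀, φ, hR₀, hφ, hφc, hφa, hφR, hφt⟩ := exists_phi hq hig hig_hl
  obtain ⟨ψ, hψ, hψc, hψm, hψl⟩ := exists_psi hq hh hθ hhl
  refine ⟨R₀, φ, ψ, hR₀, hφ, hφc, hφa, hφR, hφt, hψ, hψc, hψm, hψl, ?_⟩
  -- Near `0`, `φ` exceeds `ψ R₀`, the largest value of `ψ` on `[0, R₀]`.
  obtain ⟨R₁, hR₁φ, hR₁⟩ := ((hφt.eventually_ge_atTop (ψ R₀)).and (Ioc_mem_nhdsGT hR₀)).exists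
  have hsub : Icc R₁ R₀ ⊆ Ioc 0 R₀ := fun x hx => ⟨hR₁.1.trans_le hx.1, hx.2⟩
  have hsub' : Ioc 0 R₀ ⊆ Ici 0 := fun x hx => hx.1.le
  have h0 : φ R₀ - ψ R₀ ≤ 0 := by
    have := hψl R₀ hR₀.le
    linarith
  have h1 : 0 ≤ φ R₁ - ψ R₁ := by
    have := hψm.monotoneOn (hsub' hR₁) hR₀.le hR₁.2
    linarith
  obtain ⟨R, hR, hR0⟩ := intermediate_value_Icc' hR₁.2
    ((hφc.mono hsub).sub (hψc.mono (hsub.trans hsub'))) ⟨h0, h1⟩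
  have hRI := hsub hR
  have heq : φ R = ψ R := sub_eq_zero.1 hR0
  refine ⟨R, ψ R, ?_, ?_⟩
  · have hopen : IsOpen ({p : ℝ × ℝ | 0 < p.1} ∩ {p | q * p.1 / θhl < p.2}) :=
      (isOpen_lt (by fun_prop) (by fun_prop)).inter (isOpen_lt (by fun_prop) (by fun_prop))
    have hsubQ : {p : ℝ × ℝ | 0 < p.1} ∩ {p | q * p.1 / θhl < p.2} ⊆ Qplus q θhl :=
      fun p hp => ⟨hp.1, le_of_lt hp.2⟩
    exact interior_maximal hsubQ hopen ⟨hRI.1, hψl R hRI.1.le⟩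
  · ext ⟨x, y⟩
    simp only [mem_inter_iff, mem_graphOn, mem_singleton_iff, Prod.mk.injEq]
    constructor
    · rintro ⟨⟨hx, hxy⟩, -, hxy'⟩
      have hxR : x = R := by
        rcases lt_trichotomy x R with hlt | h | hlt
        · have := hφa hx hRI hlt
          have := hψm (hsub' hx) (hsub' hRI) hlt
          linarith
        · exact h
        · have := hφa hRI hx hlt
          have := hψm (hsub' hRI) (hsub' hx) hlt
          linarith
      subst hxR
      exact ⟨rfl, hxy'.symm⟩
    · rintro ⟨rfl, rfl⟩
      exact ⟨⟨hRI, heq⟩, hsub' hRI, rfl⟩
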